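/- Let $k\ge 0$, let $p_1,\dots,p_k$ be (not necessarily distinct) odd primes, let $r_1,\dots,r_k\ge 0$ be integers, and let $G=\mathbb{Z}_{p_1^{r_1}}\times\cdots\times\mathbb{Z}_{p_k^{r_k}}$. **Definitions.** The spread $\operatorname{spr}(G)$ is the number of invariant factors of $G$, i.e. the number $n$ such that $G\cong\mathbb{Z}_{\alpha_1}\times\cdots\times\mathbb{Z}_{\alpha_n}$ with all $\alpha_i>1$ and $\alpha_i\mid\alpha_{i+1}$. In the achievement game $\mathsf{GEN}(G)$ two players alternately select previously unselected elements of $G$ until the set of jointly selected elements generates $G$; then the game is over, and the player who cannot move loses. A position is the set of selected elements, starting with $\emptyset$; $\operatorname{Opt}(P)$ is the set of positions reachable from $P$ in one move. The nim-number of a position is $\operatorname{nim}(P)=\operatorname{mex}\{\operatorname{nim}(Q)\mid Q\in\operatorname{Opt}(P)\}$, and the nim-number of the game is $\operatorname{nim}(\emptyset)$. For impartial games, $X=Y$ means that $X+T$ and $Y+T$ have the same outcome for every impartial game $T$; the nimber $*n$ is the game with options $*0,\dots,*(n-1)$. An intersection subgroup of $G$ is an intersection of a nonempty family of maximal subgroups.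 For an intersection subgroup $I$, the structure class $X_I$ is the set of subsets of $I$ that are not contained in a smaller intersection subgroup; $X_G$ is the set of generating sets $S$ of $G$ such that $S\setminus\{s\}$ does not generate $G$ for some $s\in S$. Write $\operatorname{pty}(n)=n \bmod 2$, and call a set even or odd according to its size. The class $X_J$ is an option of $X_I$ if $\operatorname{Opt}(I)\cap X_J\neq\emptyset$, where $\operatorname{Opt}(I)=\{I\cup\{g\}\mid g\in G\setminus I\}$ for $I\ne G$ and $\operatorname{Opt}(G)=\emptyset$. The type of $X_I$ is $(\operatorname{pty}(|I|),\operatorname{nim}(P),\operatorname{nim}(Q))$, where $P$ is any even and $Q$ any odd position in $X_I$. $\operatorname{Otype}(X_I)$ is the set of the types of $X_I$ and of all options of $X_I$. Two structure classes are type equivalent if they have the same type and the same $\operatorname{Otype}$. The simplified structure diagram of $\mathsf{GEN}(G)$ is obtained from the digraph of structure classes, with an arrow from each class to each of its options and with every class labelled by its type, by identifying type equivalent classes and removing the resulting loops. **Statement.** (1) If $1\le\operatorname{spr}(G)$, put $m=\min(\operatorname{spr}(G),4)$. All types that occur are well defined, and the simplified structure diagram of $\mathsf{GEN}(G)$ is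 the directed path $v_m\to v_{m-1}\to\cdots\to v_1\to v_0$, in which $v_0$ is the vertex of $X_G$ and has type $(1,0,0)$, $v_1$ has type $(1,2,1)$, $v_2$ has type $(1,2,0)$, and $v_3$ and $v_4$ have type $(1,1,0)$ (as far as these vertices are present). (2) As impartial games, $$\mathsf{GEN}(G)=\begin{cases}*0,&\operatorname{spr}(G)=0,\\ *2,&1\le\operatorname{spr}(G)\le2,\\ *1,&\operatorname{spr}(G)\ge3,\end{cases}$$ and in particular the nim-number of $\mathsf{GEN}(G)$ is $0$, $2$, $1$, respectively. -/

import Mathlib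

/-! ### Impartial games -/

/-- An impartial game: a finite set of positions with a starting position, the set of options of
each position, and no infinite line of play. -/
structure ImpartialGame where
  Pos : Type
  finite_pos : Finite Pos
  start : Pos
  opt : Pos → Set Pos
  wf : WellFounded fun Q P => Q ∈ opt P

/-- The minimum excludant of a set of natural numbers. -/
noncomputable def mex (A : Set ℕ) : ℕ := sInf Aᶜ

namespace ImpartialGame

/-- The nim-number of a position: the minimum excludant of the nim-numbers of its options. -/
noncomputable def nim (X : ImpartialGame) : X.Pos → ℕ :=
  X.wf.fix fun P ih => mex {n | ∃ (Q : X.Pos) (h : Q ∈ X.opt P), ih Q h = n}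

theorem nim_eq (X : ImpartialGame) (P : X.Pos) : X.nim P = mex (X.nim '' X.opt P) := by
  unfold nim
  rw [WellFounded.fix_eq]
  congr 1
  ext n
  simp

/-- The nim-number of a game is the nim-number of its starting position. -/
noncomputable def nimNumber (X : ImpartialGame) : ℕ := X.nim X.start

/-- `X.IsN P`: the player about to move from `P` wins, that is, some option of `P` is a position
from which the player about to move does not win. (A player who cannot move loses.) -/
def IsN (X : ImpartialGame) : X.Pos → Prop :=
  X.wf.fix fun P ih => ∃ (Q : X.Pos) (h : Q ∈ X.opt P), ¬ ih Q h

theorem isN_iff (X : ImpartialGame) (P : X.Pos) : X.IsN P ↔ ∃ Q ∈ X.opt P, ¬ X.IsN Q := by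
  unfold IsN
  rw [WellFounded.fix_eq]
  simp

/-- The sum of two games: a move is a move in exactly one of the two components. -/
def add (X Y : ImpartialGame) : ImpartialGame where
  Pos := X.Pos × Y.Pos
  finite_pos := by
    have := X.finite_pos
    have := Y.finite_pos
    infer_instance
  start := (X.start, Y.start)
  opt P := {Q | (Q.1 ∈ X.opt P.1 ∧ Q.2 = P.2) ∨ (Q.2 ∈ Y.opt P.2 ∧ Q.1 = P.1)}
  wf := by
    refine Subrelation.wf ?_ (X.wf.prod_gameAdd Y.wf)
    intro Q P h
    exact Prod.gameAdd_iff.2 h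

/-- Equality of games: `X + T` and `Y + T` have the same outcome for every game `T`. -/
def Equal (X Y : ImpartialGame) : Prop :=
  ∀ T : ImpartialGame, (X.add T).IsN (X.add T).start ↔ (Y.add T).IsN (Y.add T).start

/-- The nimber `*n`: the position `*a` has the options `*b` with `b < a`; the start is `*n`. -/
def nimber (n : ℕ) : ImpartialGame where
  Pos := Fin (n + 1)
  finite_pos := inferInstance
  start := Fin.last n
  opt a := {b | b < a}
  wf := wellFounded_lt

end ImpartialGame

/-! ### The achievement game of a finite group (written additively) -/

section Achievement

variable {G : Type} [AddGroup G]

/-- The options of a set `P` of selected elements: if `P` does not generate the group yet, a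
previously unselected element is added; if `P` generates the group, the game is over. -/
def genOpt (P : Set G) : Set (Set G) :=
  {Q | AddSubgroup.closure P ≠ ⊤ ∧ ∃ g ∉ P, Q = insert g P}

/-- The sets that occur in the game: the empty set, and the sets `S` in which some element `s` can
have been selected last, that is, `S \ {s}` does not generate the group. -/
def IsGenPosition (S : Set G) : Prop :=
  S = ∅ ∨ ∃ s ∈ S, AddSubgroup.closure (S \ {s}) ≠ ⊤

theorem IsGenPosition.of_mem_genOpt {P Q : Set G} (h : Q ∈ genOpt P) : IsGenPosition Q := by
  obtain ⟨hP, g, hg, rfl⟩ := h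
  refine Or.inr ⟨g, Set.mem_insert g P, ?_⟩
  rwa [Set.insert_sdiff_self_of_notMem hg]

variable (G) in
/-- The achievement game `GEN(G)`. -/
def GEN [Finite G] : ImpartialGame where
  Pos := {S : Set G // IsGenPosition S}
  finite_pos := inferInstance
  start := ⟨∅, Or.inl rfl⟩
  opt P := {Q | Q.1 ∈ genOpt P.1}
  wf := by
    refine Subrelation.wf (r := InvImage (fun A B : Set G => B < A) Subtype.val) ?_
      (InvImage.wf _ wellFounded_gt)
    rintro Q P ⟨-, g, hg, hQ⟩
    change P.1 < Q.1
    rw [hQ]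
    exact Set.ssubset_insert hg

/-! ### Structure classes and the simplified structure diagram -/

/-- An intersection subgroup: an intersection of a nonempty family of maximal subgroups. -/
def IsIntersectionSubgroup (I : AddSubgroup G) : Prop :=
  ∃ N : Set (AddSubgroup G), N.Nonempty ∧ (∀ M ∈ N, IsCoatom M) ∧ I = sInf N

variable (G) in
/-- The index set of the structure classes of `GEN(G)`: the intersection subgroups and `G`. -/
def StructureIndex : Type := {I : AddSubgroup G // IsIntersectionSubgroup I ∨ I = ⊤}

open Classical in
/-- The structure class `X_I`. For an intersection subgroup `I` it consists of the subsets of `I`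
that are not contained in a smaller intersection subgroup; `X_G` consists of the generating sets
`S` such that `S \ {s}` does not generate for some `s ∈ S`. -/
def structureClass (I : StructureIndex G) : Set (Set G) :=
  if I.1 = ⊤ then
    {S | AddSubgroup.closure S = ⊤ ∧ ∃ s ∈ S, AddSubgroup.closure (S \ {s}) ≠ ⊤}
  else
    {S | S ⊆ I.1 ∧ ∀ J : AddSubgroup G, IsIntersectionSubgroup J → J < I.1 → ¬ S ⊆ J}

/-- `X_J` is an option of `X_I` if some option of the set `I` lies in `X_J`. -/
def structureOpt (I : StructureIndex G) : Set (StructureIndex G) :=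
  {J | (genOpt (I.1 : Set G) ∩ structureClass J).Nonempty}

/-- The type of `X_I`, as the set of all triples `(pty(I), nim(P), nim(Q))` such that `P` ranges
over even and `Q` over odd positions in `X_I`, provided that all the even positions have the same
nim-number and all the odd positions have the same nim-number and both kinds exist. Thus the type of
`X_I` is well defined and equal to `t` if and only if this set is `{t}`, and it is empty
otherwise. -/
def structureType [Finite G] (I : StructureIndex G) : Set (ℕ × ℕ × ℕ) :=
  {t | t.1 = Nat.card I.1 % 2 ∧
    (∃ P : (GEN G).Pos, P.1 ∈ structureClass I ∧ Even P.1.ncard) ∧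
    (∃ Q : (GEN G).Pos, Q.1 ∈ structureClass I ∧ Odd Q.1.ncard) ∧
    (∀ P : (GEN G).Pos, P.1 ∈ structureClass I → Even P.1.ncard → (GEN G).nim P = t.2.1) ∧
    (∀ Q : (GEN G).Pos, Q.1 ∈ structureClass I → Odd Q.1.ncard → (GEN G).nim Q = t.2.2)}

/-- The option type `otype(X_I)`: the types of the options of `X_I`. -/
def optionType [Finite G] (I : StructureIndex G) : Set (ℕ × ℕ × ℕ) :=
  {t | ∃ K ∈ structureOpt I, t ∈ structureType K}

/-- The full option type `Otype(X_I)`: the types of the options of `X_I` and of `X_I` itself. -/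
def fullOptionType [Finite G] (I : StructureIndex G) : Set (ℕ × ℕ × ℕ) :=
  optionType I ∪ structureType I

variable (G) in
/-- Type equivalence of structure classes. -/
def typeEquiv [Finite G] : Setoid (StructureIndex G) where
  r I J := structureType I = structureType J ∧ fullOptionType I = fullOptionType J
  iseqv := ⟨fun _ => ⟨rfl, rfl⟩, fun h => ⟨h.1.symm, h.2.symm⟩,
    fun h h' => ⟨h.1.trans h'.1, h.2.trans h'.2⟩⟩

end Achievement

/-- A structure diagram: a digraph in which every vertex carries its type and in which the vertex
of the terminal class `X_G` is distinguished. -/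
structure StructureDiagram where
  Vertex : Type
  arrow : Vertex → Vertex → Prop
  type : Vertex → Set (ℕ × ℕ × ℕ)
  terminal : Vertex

/-- Two structure diagrams are the same up to a renaming of the vertices. -/
def StructureDiagram.Same (D E : StructureDiagram) : Prop :=
  ∃ e : D.Vertex ≃ E.Vertex, (∀ v w, D.arrow v w ↔ E.arrow (e v) (e w)) ∧
    (∀ v, D.type v = E.type (e v)) ∧ e D.terminal = E.terminal

/-- The simplified structure diagram of `GEN(G)`: type equivalent structure classes are identified
in the structure diagram and the resulting loops are removed. -/
def simplifiedStructureDiagram (G : Type) [AddGroup G] [Finite G] : StructureDiagram where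
  Vertex := Quotient (typeEquiv G)
  arrow v w := v ≠ w ∧ ∃ I J : StructureIndex G,
    Quotient.mk (typeEquiv G) I = v ∧ Quotient.mk (typeEquiv G) J = w ∧ J ∈ structureOpt I
  type := Quotient.lift (s := typeEquiv G) structureType fun _ _ h => h.1
  terminal := Quotient.mk (typeEquiv G) ⟨⊤, Or.inr rfl⟩

/-- The type at the vertex `i` of the diagrams `oddAbelianDiagram`. -/
def oddAbelianType : ℕ → ℕ × ℕ × ℕ
  | 0 => (1, 0, 0)
  | 1 => (1, 2, 1)
  | 2 => (1, 2, 0)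
  | _ => (1, 1, 0)

/-- The chain `m → m - 1 → ⋯ → 1 → 0` in which `0` is the terminal class and the vertex `i` has
the type `oddAbelianType i`. -/
def oddAbelianDiagram (m : ℕ) : StructureDiagram where
  Vertex := Fin (m + 1)
  arrow i j := (i : ℕ) = j + 1
  type i := {oddAbelianType i}
  terminal := 0

/-! ### The spread of a finite abelian group -/

/-- `α 0, …, α (n - 1)` are the invariant factors of `G`: integers greater than `1`, each dividing
the next, such that `G` is isomorphic to the product of the cyclic groups of these orders. -/
def IsInvariantFactors (G : Type) [AddCommGroup G] {n : ℕ} (α : Fin n → ℕ) : Prop :=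
  (∀ i, 1 < α i) ∧ (∀ i j, i ≤ j → α i ∣ α j) ∧ Nonempty (G ≃+ ((i : Fin n) → ZMod (α i)))

/-- The spread of a finite abelian group: the number of its invariant factors. (This number is
uniquely determined by the group.) -/
noncomputable def spr (G : Type) [AddCommGroup G] : ℕ :=
  sInf {n | ∃ α : Fin n → ℕ, IsInvariantFactors G α}

/-- The group `ℤ_{p₁^{r₁}} × ⋯ × ℤ_{p_k^{r_k}}`. -/
abbrev PrimePowerProduct {k : ℕ} (p r : Fin k → ℕ) : Type := (i : Fin k) → ZMod (p i ^ r i)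

/-! ### The minimum excludant and the Sprague–Grundy theorem -/

/-! Everything is governed by the deficiency `d` of a position, the least number of elements still
missing for generation. A move lowers `d` by 0 or 1 and flips the parity of the position. If `d >
0`, some move lowers it. Since `|G|` is odd, an even position is never a whole subgroup, so it also
has a move inside its closure that keeps `d`. Odd positions may lack such a move, but it would not
change their mex. The resulting recursion gives the (even, odd) nim-numbers (0,0), (2,1), (2,0),
(1,0), (1,0), ... for `d` = 0, 1, 2, 3, 4, ... (`nim_GEN`).

Deficiency is constant on each structure class, so the type of a class depends only on `d`, and its
Otype only on `d` and `d - 1`. Types are constant from `d = 3` on and Otypes from `d = 4` on; hence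
type equivalence is equality of `min d 4` (`typeEquiv_iff`), and the quotient is a path.

Finally, the deficiency of the empty set is the spread (`spr_eq_deficiency`), and Sprague–Grundy
turns nim-numbers into equality of games. -/

theorem mex_eq {A : Set ℕ} {n : ℕ} (h : n ∉ A) (h' : ∀ k < n, k ∈ A) : mex A = n := by
  refine le_antisymm (Nat.sInf_le h) (le_of_not_gt fun hlt => ?_)
  exact Nat.sInf_mem (s := Aᶜ) ⟨n, h⟩ (h' _ hlt)

theorem mex_notMem {A : Set ℕ} (hA : A.Finite) : mex A ∉ A :=
  Nat.sInf_mem (s := Aᶜ) hA.infinite_compl.nonempty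

theorem mem_of_lt_mex {A : Set ℕ} {n : ℕ} (h : n < mex A) : n ∈ A :=
  not_not.1 (Nat.notMem_of_lt_sInf h)

namespace ImpartialGame

theorem finite_nim_image_opt (X : ImpartialGame) (P : X.Pos) : (X.nim '' X.opt P).Finite := by
  have := X.finite_pos
  exact Set.toFinite _

theorem nim_ne_of_mem_opt (X : ImpartialGame) {P Q : X.Pos} (h : Q ∈ X.opt P) :
    X.nim Q ≠ X.nim P := by
  intro hQ
  refine mex_notMem (X.finite_nim_image_opt P) ?_
  rw [← nim_eq, ← hQ]
  exact ⟨Q, h, rfl⟩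

theorem exists_mem_opt_nim_eq (X : ImpartialGame) {P : X.Pos} {n : ℕ} (h : n < X.nim P) :
    ∃ Q ∈ X.opt P, X.nim Q = n := by
  rw [nim_eq] at h
  exact mem_of_lt_mex h

/-- A sum is won by the player about to move if and only if the nim-numbers of the two components
differ. -/
theorem isN_add_iff (X Y : ImpartialGame) (P : (X.add Y).Pos) :
    (X.add Y).IsN P ↔ X.nim P.1 ≠ Y.nim P.2 := by
  induction P using (X.add Y).wf.induction with
  | _ P ih =>
  rw [isN_iff]
  constructor
  · rintro ⟨Q, hQ, hN⟩ heq
    rw [ih Q hQ, not_not] at hN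
    rcases hQ with ⟨h, h'⟩ | ⟨h, h'⟩
    · exact X.nim_ne_of_mem_opt h (by rw [hN, h', heq])
    · exact Y.nim_ne_of_mem_opt h (by rw [← hN, h', heq])
  · intro hne
    rcases lt_or_gt_of_ne hne with h | h
    · obtain ⟨Q, hQ, hn⟩ := Y.exists_mem_opt_nim_eq h
      have hQ' : (P.1, Q) ∈ (X.add Y).opt P := Or.inr ⟨hQ, rfl⟩
      exact ⟨_, hQ', by rw [ih _ hQ', not_not]; exact hn.symm⟩
    · obtain ⟨Q, hQ, hn⟩ := X.exists_mem_opt_nim_eq h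
      have hQ' : (Q, P.2) ∈ (X.add Y).opt P := Or.inl ⟨hQ, rfl⟩
      exact ⟨_, hQ', by rw [ih _ hQ', not_not]; exact hn⟩

theorem nim_nimber (n : ℕ) (a : Fin (n + 1)) : (nimber n).nim a = a := by
  induction a using WellFoundedLT.induction with
  | _ a ih =>
  refine ((nimber n).nim_eq a).trans (mex_eq ?_ fun k hk => ⟨⟨k, hk.trans a.2⟩, hk, ih _ hk⟩)
  rintro ⟨b, hb, h⟩
  exact Fin.val_ne_of_ne (LT.lt.ne (α := Fin (n + 1)) hb) ((ih b hb).symm.trans h)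

/-- By `isN_add_iff` the outcome of a sum with `T` sees the other summand only through its
nim-number. -/
theorem equal_nimber (X : ImpartialGame) {n : ℕ} (h : X.nimNumber = n) : X.Equal (nimber n) := by
  intro T
  rw [isN_add_iff, isN_add_iff]
  change X.nimNumber ≠ _ ↔ (nimber n).nim (Fin.last n) ≠ _
  rw [nim_nimber, h, Fin.val_last]
  rfl

end ImpartialGame

/-! ### The deficiency of a set of group elements -/

section Deficiency

variable {G : Type} [AddGroup G]

/-- The deficiency of `P`: the least number of elements that have to be added to `P` in order to
generate the group. -/
noncomputable def deficiency (P : Set G) : ℕ :=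
  sInf {n | ∃ T : Finset G, T.card = n ∧ AddSubgroup.closure (P ∪ T) = ⊤}

theorem deficiency_le {P : Set G} (T : Finset G) (h : AddSubgroup.closure (P ∪ T) = ⊤) :
    deficiency P ≤ T.card :=
  Nat.sInf_le ⟨T, rfl, h⟩

theorem exists_card_eq_deficiency [Finite G] (P : Set G) :
    ∃ T : Finset G, T.card = deficiency P ∧ AddSubgroup.closure (P ∪ T) = ⊤ := by
  have := Fintype.ofFinite G
  exact Nat.sInf_mem (s := {n | ∃ T : Finset G, T.card = n ∧ AddSubgroup.closure (P ∪ T) = ⊤})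
    ⟨_, Finset.univ, rfl, by simp⟩

theorem deficiency_eq_zero [Finite G] {P : Set G} :
    deficiency P = 0 ↔ AddSubgroup.closure P = ⊤ := by
  constructor
  · intro h
    obtain ⟨T, hT, hP⟩ := exists_card_eq_deficiency P
    rw [h, Finset.card_eq_zero] at hT
    simpa [hT] using hP
  · intro h
    simpa using deficiency_le (P := P) ∅ (by simpa using h)

theorem deficiency_anti [Finite G] {P Q : Set G} (h : P ⊆ Q) : deficiency Q ≤ deficiency P := by
  obtain ⟨T, hT, hP⟩ := exists_card_eq_deficiency P
  rw [← hT]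
  exact deficiency_le T (top_le_iff.1 (hP ▸ AddSubgroup.closure_mono (Set.union_subset_union_left _ h)))

theorem deficiency_le_insert_add_one [Finite G] (P : Set G) (g : G) :
    deficiency P ≤ deficiency (insert g P) + 1 := by
  classical
  obtain ⟨T, hT, hP⟩ := exists_card_eq_deficiency (insert g P)
  rw [← hT]
  refine (deficiency_le (insert g T) ?_).trans (Finset.card_insert_le g T)
  rw [← hP]
  congr 1
  ext x
  simp only [Finset.coe_insert, Set.mem_union, Set.mem_insert_iff]
  tauto

/-- Some element decreases the deficiency of a set that does not generate the group. -/
theorem exists_deficiency_insert [Finite G] {P : Set G} {d : ℕ} (h : deficiency P = d + 1) :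
    ∃ g ∉ P, deficiency (insert g P) = d := by
  classical
  obtain ⟨T, hT, hP⟩ := exists_card_eq_deficiency P
  obtain ⟨g, hg⟩ : T.Nonempty := Finset.card_pos.1 (by omega)
  have hle : deficiency (insert g P) ≤ d := by
    have : (T.erase g).card = d := by rw [Finset.card_erase_of_mem hg]; omega
    rw [← this]
    apply deficiency_le
    rw [← hP]
    congr 1
    ext x
    by_cases hx : x = g <;> simp [hx, hg]
  have hge := deficiency_le_insert_add_one P g
  refine ⟨g, fun hgP => ?_, by omega⟩
  rw [Set.insert_eq_of_mem hgP] at hle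
  omega

theorem deficiency_congr {P Q : Set G}
    (h : ∀ T : Set G, AddSubgroup.closure (P ∪ T) = ⊤ ↔ AddSubgroup.closure (Q ∪ T) = ⊤) :
    deficiency P = deficiency Q := by
  unfold deficiency
  simp only [h]

theorem deficiency_insert_of_mem_closure {P : Set G} {g : G} (h : g ∈ AddSubgroup.closure P) :
    deficiency (insert g P) = deficiency P := by
  refine deficiency_congr fun T => ?_
  have hg : AddSubgroup.closure {g} ≤ AddSubgroup.closure P :=
    (AddSubgroup.closure_le _).2 (Set.singleton_subset_iff.2 h)
  rw [AddSubgroup.closure_union, AddSubgroup.closure_union, Set.insert_eq,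
    AddSubgroup.closure_union, sup_eq_right.2 hg]

end Deficiency

/-! ### The nim-numbers of the positions -/

section Positions

variable {G : Type} [AddGroup G]

theorem isGenPosition_of_closure_ne_top {S : Set G} (h : AddSubgroup.closure S ≠ ⊤) :
    IsGenPosition S := by
  rcases S.eq_empty_or_nonempty with rfl | ⟨s, hs⟩
  · exact Or.inl rfl
  · refine Or.inr ⟨s, hs, fun h' => h (top_le_iff.1 ?_)⟩
    rw [← h']
    exact AddSubgroup.closure_mono Set.sdiff_subset

theorem deficiency_of_mem_opt [Finite G] {P Q : (GEN G).Pos} (h : Q ∈ (GEN G).opt P) {d : ℕ}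
    (hd : deficiency P.1 = d + 1) : deficiency Q.1 = d + 1 ∨ deficiency Q.1 = d := by
  obtain ⟨-, g, -, hQ⟩ := h
  have h₁ := deficiency_le_insert_add_one P.1 g
  have h₂ := deficiency_anti (Set.subset_insert g P.1)
  rw [hQ]
  omega

theorem even_ncard_of_mem_opt [Finite G] {P Q : (GEN G).Pos} (h : Q ∈ (GEN G).opt P) :
    Even Q.1.ncard ↔ ¬ Even P.1.ncard := by
  obtain ⟨-, g, hg, hQ⟩ := h
  rw [hQ, Set.ncard_insert_of_notMem hg, Nat.even_add_one]

theorem exists_mem_opt [Finite G] {P : (GEN G).Pos} {g : G} (hg : g ∉ P.1) (hP : deficiency P.1 ≠ 0) :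
    ∃ Q ∈ (GEN G).opt P, Q.1 = insert g P.1 := by
  have h : insert g P.1 ∈ genOpt P.1 := ⟨fun h => hP (deficiency_eq_zero.2 h), g, hg, rfl⟩
  exact ⟨⟨_, IsGenPosition.of_mem_genOpt h⟩, h, rfl⟩

theorem exists_mem_opt_deficiency_eq [Finite G] {P : (GEN G).Pos} {d : ℕ} (hd : deficiency P.1 = d + 1) :
    ∃ Q ∈ (GEN G).opt P, deficiency Q.1 = d := by
  obtain ⟨g, hg, hgd⟩ := exists_deficiency_insert hd
  obtain ⟨Q, hQ, h⟩ := exists_mem_opt hg (by omega)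
  exact ⟨Q, hQ, h ▸ hgd⟩

theorem odd_card_addSubgroup (hG : Odd (Nat.card G)) (H : AddSubgroup G) : Odd (Nat.card H) :=
  hG.of_dvd_nat H.card_addSubgroup_dvd_card

/-- In a group of odd order, an even position has an option of the same deficiency. -/
theorem exists_mem_opt_same_deficiency [Finite G] (hG : Odd (Nat.card G)) {P : (GEN G).Pos} {d : ℕ}
    (hd : deficiency P.1 = d + 1) (hP : Even P.1.ncard) :
    ∃ Q ∈ (GEN G).opt P, deficiency Q.1 = d + 1 := by
  -- The closure has odd order, so a set of even size cannot exhaust it; any element in the gap is a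
  -- move that keeps the closure.
  have hss : P.1 ⊂ AddSubgroup.closure P.1 := by
    refine lt_of_le_of_ne AddSubgroup.subset_closure fun h => ?_
    have hodd := odd_card_addSubgroup hG (AddSubgroup.closure P.1)
    rw [← SetLike.coe_sort_coe, ← h, Nat.card_coe_set_eq] at hodd
    exact Nat.not_even_iff_odd.2 hodd hP
  obtain ⟨g, hg, hgP⟩ := Set.exists_of_ssubset hss
  obtain ⟨Q, hQ, h⟩ := exists_mem_opt hgP (by omega)
  exact ⟨Q, hQ, by rw [h, deficiency_insert_of_mem_closure hg, hd]⟩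

/-- Recursion step for an even position of deficiency `d + 1`: its options are odd, and both
deficiencies `d + 1` and `d` occur. -/
theorem mex_oddAbelianType_even {A : Set ℕ} (d : ℕ)
    (h₁ : ∀ a ∈ A, a = (oddAbelianType (d + 1)).2.2 ∨ a = (oddAbelianType d).2.2)
    (h₂ : (oddAbelianType (d + 1)).2.2 ∈ A) (h₃ : (oddAbelianType d).2.2 ∈ A) :
    mex A = (oddAbelianType (d + 1)).2.1 := by
  apply mex_eq
  · intro h
    have := h₁ _ h
    rcases d with _ | _ | _ | d <;> simp [oddAbelianType] at this
  · intro k hk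
    rcases d with _ | _ | _ | d <;> (simp only [oddAbelianType] at hk h₂ h₃; interval_cases k <;> assumption)

/-- Recursion step for an odd position of deficiency `d + 1`: only an option of deficiency `d` is
guaranteed. That already covers all values below the claimed mex, and an option of deficiency `d +
1` never has the claimed value. -/
theorem mex_oddAbelianType_odd {A : Set ℕ} (d : ℕ)
    (h₁ : ∀ a ∈ A, a = (oddAbelianType (d + 1)).2.1 ∨ a = (oddAbelianType d).2.1)
    (h₂ : (oddAbelianType d).2.1 ∈ A) :
    mex A = (oddAbelianType (d + 1)).2.2 := by
  apply mex_eq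
  · intro h
    have := h₁ _ h
    rcases d with _ | _ | _ | d <;> simp [oddAbelianType] at this
  · intro k hk
    rcases d with _ | _ | _ | d <;> (simp only [oddAbelianType] at hk h₂; interval_cases k <;> assumption)

/-- In a group of odd order, the nim-number of a position depends only on its deficiency and on
its parity. -/
theorem nim_GEN [Finite G] (hG : Odd (Nat.card G)) (P : (GEN G).Pos) :
    (Even P.1.ncard → (GEN G).nim P = (oddAbelianType (deficiency P.1)).2.1) ∧
      (¬ Even P.1.ncard → (GEN G).nim P = (oddAbelianType (deficiency P.1)).2.2) := by
  induction P using (GEN G).wf.induction with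
  | _ P ih =>
  rw [ImpartialGame.nim_eq]
  rcases hd : deficiency P.1 with _ | d
  · have : (GEN G).opt P = ∅ :=
      Set.eq_empty_of_forall_notMem fun Q hQ => hQ.1 (deficiency_eq_zero.1 hd)
    simp [this, mex, oddAbelianType]
  · obtain ⟨Q, hQ, hQd⟩ := exists_mem_opt_deficiency_eq hd
    refine ⟨fun hP => ?_, fun hP => ?_⟩
    · have hopt : ∀ Q ∈ (GEN G).opt P,
          (GEN G).nim Q = (oddAbelianType (deficiency Q.1)).2.2 := fun Q hQ =>
        (ih Q hQ).2 fun h => (even_ncard_of_mem_opt hQ).1 h hP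
      obtain ⟨R, hR, hRd⟩ := exists_mem_opt_same_deficiency hG hd hP
      refine mex_oddAbelianType_even d ?_ ⟨R, hR, by rw [hopt R hR, hRd]⟩
        ⟨Q, hQ, by rw [hopt Q hQ, hQd]⟩
      rintro _ ⟨S, hS, rfl⟩
      rw [hopt S hS]
      rcases deficiency_of_mem_opt hS hd with h | h <;> simp [h]
    · have hopt : ∀ Q ∈ (GEN G).opt P,
          (GEN G).nim Q = (oddAbelianType (deficiency Q.1)).2.1 := fun Q hQ =>
        (ih Q hQ).1 ((even_ncard_of_mem_opt hQ).2 hP)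
      refine mex_oddAbelianType_odd d ?_ ⟨Q, hQ, by rw [hopt Q hQ, hQd]⟩
      rintro _ ⟨S, hS, rfl⟩
      rw [hopt S hS]
      rcases deficiency_of_mem_opt hS hd with h | h <;> simp [h]

theorem nimNumber_GEN [Finite G] (hG : Odd (Nat.card G)) :
    (GEN G).nimNumber = (oddAbelianType (deficiency (∅ : Set G))).2.1 :=
  (nim_GEN hG (GEN G).start).1 (by simp [GEN])

end Positions

/-! ### Structure classes -/

section StructureClasses

variable {G : Type} [AddGroup G]

theorem closure_ne_top_iff_exists_isCoatom [Finite G] {S : Set G} :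
    AddSubgroup.closure S ≠ ⊤ ↔ ∃ M : AddSubgroup G, IsCoatom M ∧ S ⊆ M := by
  constructor
  · intro h
    obtain ⟨M, hM, hle⟩ := (eq_top_or_exists_le_coatom (AddSubgroup.closure S)).resolve_left h
    exact ⟨M, hM, AddSubgroup.subset_closure.trans hle⟩
  · rintro ⟨M, hM, hS⟩ h
    exact hM.1 (top_le_iff.1 (h ▸ (AddSubgroup.closure_le M).2 hS))

theorem IsIntersectionSubgroup.inf_coatom {I M : AddSubgroup G} (hI : IsIntersectionSubgroup I)
    (hM : IsCoatom M) : IsIntersectionSubgroup (I ⊓ M) := by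
  obtain ⟨N, -, hN, rfl⟩ := hI
  refine ⟨insert M N, Set.insert_nonempty _ _, ?_, by rw [sInf_insert, inf_comm]⟩
  rintro K (rfl | hK)
  exacts [hM, hN K hK]

theorem IsIntersectionSubgroup.ne_top {I : AddSubgroup G} (hI : IsIntersectionSubgroup I) :
    I ≠ ⊤ := by
  obtain ⟨N, ⟨M, hM⟩, hN, rfl⟩ := hI
  exact fun h => (hN M hM).1 (top_le_iff.1 (h ▸ sInf_le hM))

theorem mem_structureClass_of_eq_top {I : StructureIndex G} (h : I.1 = ⊤) {S : Set G} :
    S ∈ structureClass I ↔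
      AddSubgroup.closure S = ⊤ ∧ ∃ s ∈ S, AddSubgroup.closure (S \ {s}) ≠ ⊤ := by
  rw [structureClass, if_pos h]
  rfl

theorem mem_structureClass_of_ne_top {I : StructureIndex G} (h : I.1 ≠ ⊤) {S : Set G} :
    S ∈ structureClass I ↔
      S ⊆ I.1 ∧ ∀ J : AddSubgroup G, IsIntersectionSubgroup J → J < I.1 → ¬ S ⊆ J := by
  rw [structureClass, if_neg h]
  rfl

/-- All members of a structure class have the deficiency of its index. -/
theorem deficiency_of_mem_structureClass [Finite G] {I : StructureIndex G} {S : Set G}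
    (hS : S ∈ structureClass I) : deficiency S = deficiency (I.1 : Set G) := by
  by_cases h : I.1 = ⊤
  · rw [mem_structureClass_of_eq_top h] at hS
    rw [deficiency_eq_zero.2 hS.1, deficiency_eq_zero.2 (by rw [AddSubgroup.closure_eq, h])]
  · rw [mem_structureClass_of_ne_top h] at hS
    refine deficiency_congr fun T => not_iff_not.1 ?_
    rw [← ne_eq, ← ne_eq, closure_ne_top_iff_exists_isCoatom, closure_ne_top_iff_exists_isCoatom]
    refine exists_congr fun M => and_congr_right fun hM => ?_
    rw [Set.union_subset_iff, Set.union_subset_iff]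
    refine and_congr_left fun _ => ⟨fun hSM => ?_, hS.1.trans⟩
    -- Otherwise `I ⊓ M` would be a smaller intersection subgroup containing `S`. So `S` and `I` lie
    -- in the same maximal subgroups.
    by_contra hIM
    refine hS.2 _ ((I.2.resolve_right h).inf_coatom hM) (inf_lt_left.2 hIM) ?_
    exact Set.subset_inter hS.1 hSM

/-- Every set that does not generate the group lies in a structure class. -/
theorem exists_mem_structureClass [Finite G] {S : Set G} (h : AddSubgroup.closure S ≠ ⊤) :
    ∃ I : StructureIndex G, S ∈ structureClass I := by
  -- The index is the smallest intersection subgroup containing `S`.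
  have hI : IsIntersectionSubgroup (sInf {M : AddSubgroup G | IsCoatom M ∧ S ⊆ M}) :=
    ⟨_, closure_ne_top_iff_exists_isCoatom.1 h, fun M hM => hM.1, rfl⟩
  refine ⟨⟨_, Or.inl hI⟩, (mem_structureClass_of_ne_top hI.ne_top).2 ⟨?_, ?_⟩⟩
  · intro x hx
    exact AddSubgroup.mem_sInf.2 fun M hM => hM.2 hx
  · rintro J ⟨N, -, hN, rfl⟩ hlt hS
    refine hlt.not_ge (le_sInf fun M hM => sInf_le ⟨hN M hM, hS.trans ?_⟩)
    exact SetLike.coe_subset_coe.2 (sInf_le hM)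

theorem exists_mem_structureOpt [Finite G] {I : StructureIndex G} {d : ℕ}
    (hd : deficiency (I.1 : Set G) = d + 1) :
    ∃ J ∈ structureOpt I, deficiency (J.1 : Set G) = d := by
  have hI : AddSubgroup.closure (I.1 : Set G) ≠ ⊤ := fun h => by
    rw [deficiency_eq_zero.2 h] at hd
    omega
  obtain ⟨g, hg, hgd⟩ := exists_deficiency_insert hd
  obtain ⟨J, hJ⟩ : ∃ J : StructureIndex G, insert g (I.1 : Set G) ∈ structureClass J := by
    by_cases h : AddSubgroup.closure (insert g (I.1 : Set G)) = ⊤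
    · refine ⟨⟨⊤, Or.inr rfl⟩, (mem_structureClass_of_eq_top rfl).2 ⟨h, g, by simp, ?_⟩⟩
      rwa [Set.insert_sdiff_self_of_notMem hg]
    · exact exists_mem_structureClass h
  exact ⟨J, ⟨_, ⟨hI, g, hg, rfl⟩, hJ⟩, by rw [← deficiency_of_mem_structureClass hJ, hgd]⟩

theorem deficiency_of_mem_structureOpt [Finite G] {I J : StructureIndex G} (h : J ∈ structureOpt I) :
    deficiency (J.1 : Set G) = deficiency (I.1 : Set G) ∨
      deficiency (J.1 : Set G) + 1 = deficiency (I.1 : Set G) := by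
  obtain ⟨S, ⟨-, g, -, rfl⟩, hS⟩ := h
  have h₁ := deficiency_le_insert_add_one (I.1 : Set G) g
  have h₂ := deficiency_anti (Set.subset_insert g (I.1 : Set G))
  rw [deficiency_of_mem_structureClass hS] at h₁ h₂
  omega

/-- Every number up to the deficiency of `∅` is the deficiency of an index. -/
theorem exists_structureIndex_deficiency_eq [Finite G] {d : ℕ} (hd : d ≤ deficiency (∅ : Set G)) :
    ∃ I : StructureIndex G, deficiency (I.1 : Set G) = d := by
  -- Start at the class of the empty set and descend, since each class of positive deficiency has an
  -- option of deficiency one less.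
  induction hd using Nat.decreasingInduction with
  | self =>
    by_cases h : AddSubgroup.closure (∅ : Set G) = ⊤
    · exact ⟨⟨⊤, Or.inr rfl⟩, by rw [deficiency_eq_zero.2 h, deficiency_eq_zero.2 (by simp)]⟩
    · obtain ⟨I, hI⟩ := exists_mem_structureClass h
      exact ⟨I, (deficiency_of_mem_structureClass hI).symm⟩
  | of_succ d _ ih =>
    obtain ⟨I, hI⟩ := ih
    obtain ⟨J, -, hJ⟩ := exists_mem_structureOpt hI
    exact ⟨J, hJ⟩

/-- Dropping 0 switches the parity of a set without changing what it generates; this supplies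
members of both parities in each class. -/
theorem closure_sdiff_zero (H : AddSubgroup G) : AddSubgroup.closure ((H : Set G) \ {0}) = H := by
  refine le_antisymm ((AddSubgroup.closure_le H).2 Set.sdiff_subset) fun x hx => ?_
  by_cases h : x = 0
  · rw [h]
    exact zero_mem _
  · exact AddSubgroup.subset_closure ⟨hx, h⟩

theorem odd_ncard_addSubgroup (hG : Odd (Nat.card G)) (H : AddSubgroup G) :
    Odd (H : Set G).ncard := by
  rw [← Nat.card_coe_set_eq]
  exact odd_card_addSubgroup hG H

theorem even_ncard_sdiff_zero [Finite G] (hG : Odd (Nat.card G)) (H : AddSubgroup G) :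
    Even ((H : Set G) \ {0}).ncard := by
  rw [Set.ncard_sdiff_singleton_of_mem H.zero_mem]
  exact Nat.Odd.sub_odd (odd_ncard_addSubgroup hG H) odd_one

/-- Every structure class contains even and odd positions. -/
theorem exists_even_odd_mem_structureClass [Finite G] [Nontrivial G] (hG : Odd (Nat.card G))
    (I : StructureIndex G) :
    (∃ P : (GEN G).Pos, P.1 ∈ structureClass I ∧ Even P.1.ncard) ∧
      (∃ Q : (GEN G).Pos, Q.1 ∈ structureClass I ∧ Odd Q.1.ncard) := by
  by_cases h : I.1 = ⊤
  · simp only [mem_structureClass_of_eq_top h]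
    -- For `X_G`, adjoin an outside element `g` to a maximal subgroup `M` or to `M \ {0}`;
    -- nontriviality provides `M`.
    obtain ⟨M, hM, -⟩ :=
      (eq_top_or_exists_le_coatom (⊥ : AddSubgroup G)).resolve_left bot_ne_top
    obtain ⟨g, -, hg⟩ := SetLike.exists_of_lt hM.lt_top
    have key : ∀ S : Set G, S ⊆ M → AddSubgroup.closure S = M →
        AddSubgroup.closure (insert g S) = ⊤ ∧
          ∃ s ∈ insert g S, AddSubgroup.closure (insert g S \ {s}) ≠ ⊤ := by
      intro S hS hSM
      refine ⟨hM.2 _ (lt_of_le_of_ne ?_ ?_), g, by simp, ?_⟩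
      · conv_lhs => rw [← hSM]
        exact AddSubgroup.closure_mono (Set.subset_insert _ _)
      · intro h
        exact hg (h ▸ AddSubgroup.subset_closure (Set.mem_insert g S))
      · rw [Set.insert_sdiff_self_of_notMem fun h => hg (hS h), hSM]
        exact hM.1
    have h₁ := key M subset_rfl (AddSubgroup.closure_eq M)
    have h₂ := key _ Set.sdiff_subset (closure_sdiff_zero M)
    refine ⟨⟨⟨_, Or.inr h₁.2⟩, h₁, ?_⟩, ⟨⟨_, Or.inr h₂.2⟩, h₂, ?_⟩⟩
    · rw [Set.ncard_insert_of_notMem hg]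
      exact (odd_ncard_addSubgroup hG M).add_one
    · rw [Set.ncard_insert_of_notMem fun h => hg h.1]
      exact (even_ncard_sdiff_zero hG M).add_one
  · simp only [mem_structureClass_of_ne_top h]
    refine ⟨⟨⟨(I.1 : Set G) \ {0}, isGenPosition_of_closure_ne_top ?_⟩,
      ⟨Set.sdiff_subset, fun J _ hJ hS => hJ.not_ge ?_⟩, even_ncard_sdiff_zero hG _⟩,
      ⟨⟨I.1, isGenPosition_of_closure_ne_top ?_⟩, ⟨subset_rfl, fun J _ hJ hS => hJ.not_ge hS⟩,
      odd_ncard_addSubgroup hG _⟩⟩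
    · rwa [closure_sdiff_zero]
    · rw [← closure_sdiff_zero I.1]
      exact (AddSubgroup.closure_le J).2 hS
    · rwa [AddSubgroup.closure_eq]

theorem structureType_eq [Finite G] [Nontrivial G] (hG : Odd (Nat.card G)) (I : StructureIndex G) :
    structureType I = {oddAbelianType (deficiency (I.1 : Set G))} := by
  have hfst : ∀ d, (oddAbelianType d).1 = 1 := by
    rintro (_ | _ | _ | d) <;> rfl
  have heven : ∀ P : (GEN G).Pos, P.1 ∈ structureClass I → Even P.1.ncard →
      (GEN G).nim P = (oddAbelianType (deficiency (I.1 : Set G))).2.1 := fun P hP h => by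
    rw [← deficiency_of_mem_structureClass hP, (nim_GEN hG P).1 h]
  have hodd : ∀ P : (GEN G).Pos, P.1 ∈ structureClass I → Odd P.1.ncard →
      (GEN G).nim P = (oddAbelianType (deficiency (I.1 : Set G))).2.2 := fun P hP h => by
    rw [← deficiency_of_mem_structureClass hP, (nim_GEN hG P).2 (Nat.not_even_iff_odd.2 h)]
  have hcard : Nat.card I.1 % 2 = 1 := Nat.odd_iff.1 (odd_card_addSubgroup hG I.1)
  obtain ⟨hex₁, hex₂⟩ := exists_even_odd_mem_structureClass hG I
  ext t
  rw [Set.mem_singleton_iff]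
  constructor
  · rintro ⟨h₁, ⟨P, hP, hPe⟩, ⟨Q, hQ, hQo⟩, h₂, h₃⟩
    refine Prod.ext (by rw [h₁, hcard, hfst]) (Prod.ext ?_ ?_)
    · rw [← h₂ P hP hPe, heven P hP hPe]
    · rw [← h₃ Q hQ hQo, hodd Q hQ hQo]
  · rintro rfl
    exact ⟨by rw [hcard, hfst], hex₁, hex₂, heven, hodd⟩

theorem fullOptionType_eq [Finite G] [Nontrivial G] (hG : Odd (Nat.card G)) (I : StructureIndex G) :
    fullOptionType I = {oddAbelianType (deficiency (I.1 : Set G)),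
      oddAbelianType (deficiency (I.1 : Set G) - 1)} := by
  simp only [fullOptionType, optionType, structureType_eq hG]
  ext t
  simp only [Set.mem_union, Set.mem_ofPred_eq, Set.mem_singleton_iff, Set.mem_insert_iff]
  constructor
  · rintro (⟨J, hJ, rfl⟩ | rfl)
    · rcases deficiency_of_mem_structureOpt hJ with h | h
      · rw [h]; exact Or.inl rfl
      · rw [← h]; exact Or.inr rfl
    · exact Or.inl rfl
  · rintro (rfl | rfl)
    · exact Or.inr rfl
    · rcases hd : deficiency (I.1 : Set G) with _ | d
      -- At deficiency 0 the truncated subtraction gives `0 - 1 = 0`, so the pair collapses to the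
      -- type of the class itself.
      · exact Or.inr rfl
      · obtain ⟨J, hJ, hJd⟩ := exists_mem_structureOpt hd
        exact Or.inl ⟨J, hJ, by rw [hJd]; rfl⟩

theorem oddAbelianType_min_four (d : ℕ) : oddAbelianType (min d 4) = oddAbelianType d := by
  rcases d with _ | _ | _ | _ | d <;> simp [oddAbelianType]

theorem oddAbelianType_min_four_sub_one (d : ℕ) :
    oddAbelianType (min d 4 - 1) = oddAbelianType (d - 1) := by
  rcases d with _ | _ | _ | _ | d <;> simp [oddAbelianType]

/-- Types separate all levels except 3 and 4; these differ because level 3 has an option of type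
`(1, 2, 0)` and level 4 does not. -/
theorem eq_of_oddAbelianType_eq {a b : ℕ} (ha : a ≤ 4) (hb : b ≤ 4)
    (h : oddAbelianType a = oddAbelianType b)
    (h' : ({oddAbelianType a, oddAbelianType (a - 1)} : Set (ℕ × ℕ × ℕ)) =
      {oddAbelianType b, oddAbelianType (b - 1)}) : a = b := by
  have h₁ : ((1, 2, 0) : ℕ × ℕ × ℕ) ∈ ({oddAbelianType a, oddAbelianType (a - 1)} : Set _) ↔
      (1, 2, 0) ∈ ({oddAbelianType b, oddAbelianType (b - 1)} : Set _) := by rw [h']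
  interval_cases a <;> interval_cases b <;> simp [oddAbelianType] at h h₁ ⊢

theorem typeEquiv_iff [Finite G] [Nontrivial G] (hG : Odd (Nat.card G)) (I J : StructureIndex G) :
    (typeEquiv G).r I J ↔
      min (deficiency (I.1 : Set G)) 4 = min (deficiency (J.1 : Set G)) 4 := by
  change structureType I = structureType J ∧ fullOptionType I = fullOptionType J ↔ _
  rw [structureType_eq hG, structureType_eq hG, fullOptionType_eq hG, fullOptionType_eq hG,
    Set.singleton_eq_singleton_iff]
  generalize deficiency (I.1 : Set G) = a
  generalize deficiency (J.1 : Set G) = b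
  rw [← oddAbelianType_min_four a, ← oddAbelianType_min_four b,
    ← oddAbelianType_min_four_sub_one a, ← oddAbelianType_min_four_sub_one b]
  constructor
  · rintro ⟨h, h'⟩
    exact eq_of_oddAbelianType_eq (min_le_right _ _) (min_le_right _ _) h h'
  · intro h
    rw [h]
    exact ⟨rfl, rfl⟩

/-- The simplified structure diagram of a nontrivial group of odd order. -/
theorem simplifiedStructureDiagram_same [Finite G] [Nontrivial G] (hG : Odd (Nat.card G)) {m : ℕ}
    (hm : m = min (deficiency (∅ : Set G)) 4) :
    (simplifiedStructureDiagram G).Same (oddAbelianDiagram m) := by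
  have hlt : ∀ I : StructureIndex G, min (deficiency (I.1 : Set G)) 4 < m + 1 := fun I => by
    have := deficiency_anti (Set.empty_subset (I.1 : Set G))
    omega
  let level : Quotient (typeEquiv G) → Fin (m + 1) :=
    Quotient.lift (s := typeEquiv G) (fun I => ⟨min (deficiency (I.1 : Set G)) 4, hlt I⟩)
      fun I J h => Fin.ext ((typeEquiv_iff hG I J).1 h)
  have hlevel : ∀ I : StructureIndex G,
      (level (Quotient.mk (typeEquiv G) I) : ℕ) = min (deficiency (I.1 : Set G)) 4 := fun _ => rfl
  have hbij : Function.Bijective level := by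
    constructor
    · rintro ⟨I⟩ ⟨J⟩ h
      exact Quotient.sound ((typeEquiv_iff hG I J).2 (congrArg Fin.val h))
    · intro i
      obtain ⟨I, hI⟩ := exists_structureIndex_deficiency_eq (G := G) (d := i) (by omega)
      refine ⟨Quotient.mk _ I, Fin.ext ?_⟩
      rw [hlevel, hI]
      omega
  refine ⟨Equiv.ofBijective level hbij, fun v w => ?_, ?_, ?_⟩
  · change (v ≠ w ∧ ∃ I J : StructureIndex G, Quotient.mk (typeEquiv G) I = v ∧
      Quotient.mk (typeEquiv G) J = w ∧ J ∈ structureOpt I) ↔ (level v : ℕ) = level w + 1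
    constructor
    · rintro ⟨hne, I, J, rfl, rfl, hJ⟩
      have hne' := Fin.val_ne_of_ne (hbij.1.ne hne)
      rw [hlevel, hlevel] at hne' ⊢
      have := deficiency_of_mem_structureOpt hJ
      omega
    · intro h
      refine ⟨fun hvw => by rw [hvw] at h; omega, ?_⟩
      have hv := (level v).2
      -- Representatives of deficiency exactly `level w + 1 ≤ 4` are chosen, so that the cap at 4
      -- does not hide the drop.
      obtain ⟨I, hI⟩ := exists_structureIndex_deficiency_eq (G := G) (d := level w + 1) (by omega)
      obtain ⟨J, hJ, hJd⟩ := exists_mem_structureOpt hI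
      refine ⟨I, J, hbij.1 (Fin.ext ?_), hbij.1 (Fin.ext ?_), hJ⟩
      · rw [hlevel, hI]; omega
      · rw [hlevel, hJd]; omega
  · rintro ⟨I⟩
    change structureType I = {oddAbelianType (min (deficiency (I.1 : Set G)) 4)}
    rw [structureType_eq hG, oddAbelianType_min_four]
  · refine Fin.ext ?_
    change min (deficiency ((⊤ : AddSubgroup G) : Set G)) 4 = 0
    rw [deficiency_eq_zero.2 (by simp)]
    rfl

end StructureClasses

/-! ### Invariant factors and the spread -/

section Spread

/-- Splitting off the last component of a product of cyclic groups. -/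
def zmodPiSnocEquiv {n : ℕ} (α : Fin (n + 1) → ℕ) :
    ((i : Fin (n + 1)) → ZMod (α i)) ≃+
      ZMod (α (Fin.last n)) × ((i : Fin n) → ZMod (α i.castSucc)) :=
  { (Fin.snocEquiv fun i => ZMod (α i)).symm with map_add' := fun _ _ => rfl }

/-- `G` has invariant factors all of which divide `N`. -/
def HasInvariantFactorsDvd (G : Type) [AddCommGroup G] (N : ℕ) : Prop :=
  ∃ (n : ℕ) (α : Fin n → ℕ), IsInvariantFactors G α ∧ ∀ i, α i ∣ N

variable {G H : Type} [AddCommGroup G] [AddCommGroup H]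

theorem HasInvariantFactorsDvd.congr {N : ℕ} (h : HasInvariantFactorsDvd G N) (e : H ≃+ G) :
    HasInvariantFactorsDvd H N := by
  obtain ⟨n, α, ⟨h₁, h₂, ⟨f⟩⟩, h₃⟩ := h
  exact ⟨n, α, ⟨h₁, h₂, ⟨e.trans f⟩⟩, h₃⟩

theorem HasInvariantFactorsDvd.mono {M N : ℕ} (h : HasInvariantFactorsDvd G M) (hMN : M ∣ N) :
    HasInvariantFactorsDvd G N := by
  obtain ⟨n, α, h₁, h₂⟩ := h
  exact ⟨n, α, h₁, fun i => (h₂ i).trans hMN⟩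

theorem HasInvariantFactorsDvd.prod_zmod {c : ℕ} (h : HasInvariantFactorsDvd G c) (hc : 1 < c) :
    HasInvariantFactorsDvd (G × ZMod c) c := by
  obtain ⟨n, α, ⟨h₁, h₂, ⟨f⟩⟩, h₃⟩ := h
  -- Substituting `c` and `α` by values of one extended tuple `β` avoids casts between the types
  -- `ZMod`.
  obtain ⟨β, hβc, hβα⟩ : ∃ β : Fin (n + 1) → ℕ, β (Fin.last n) = c ∧
      (fun i : Fin n => β i.castSucc) = α :=
    ⟨Fin.snoc α c, by simp, by simp⟩
  subst hβc hβα
  refine ⟨n + 1, β, ⟨?_, ?_, ⟨AddEquiv.prodComm.trans (((AddEquiv.refl _).prodCongr f).trans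
    (zmodPiSnocEquiv β).symm)⟩⟩, ?_⟩
  · exact Fin.lastCases hc h₁
  · intro i j hij
    induction j using Fin.lastCases with
    | last => induction i using Fin.lastCases with
      | last => exact dvd_rfl
      | cast i => exact h₃ i
    | cast j => induction i using Fin.lastCases with
      | last => exact absurd hij (Fin.castSucc_lt_last j).not_ge
      | cast i => exact h₂ i j hij
  · exact Fin.lastCases dvd_rfl h₃

/-- Insertion sort on `q`-parts: the larger of `q ^ s` and the `q`-part of the largest invariant
factor stays on top, and the smaller is pushed down the chain. The bound `N` guarantees that the new
lower factors still divide the new top one. -/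
theorem IsInvariantFactors.prod_zmod_prime_pow {q : ℕ} (hq : q.Prime) {n : ℕ} {α : Fin n → ℕ}
    (h : IsInvariantFactors G α) {s N : ℕ} (hα : ∀ i, α i ∣ N) (hs : q ^ s ∣ N) :
    HasInvariantFactorsDvd (G × ZMod (q ^ s)) N := by
  induction n generalizing G s N with
  | zero =>
    rcases Nat.eq_zero_or_pos s with rfl | hs0
    · have : Unique (ZMod (q ^ 0)) := inferInstanceAs (Unique (ZMod 1))
      exact HasInvariantFactorsDvd.congr ⟨_, α, h, hα⟩
        (AddEquiv.prodUnique (N := ZMod (q ^ 0)) (M := G))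
    · have hG : HasInvariantFactorsDvd G (q ^ s) := ⟨0, α, h, fun i => i.elim0⟩
      exact (hG.prod_zmod (Nat.one_lt_pow hs0.ne' hq.one_lt)).mono hs
  | succ n ih =>
    obtain ⟨h₁, h₂, ⟨f⟩⟩ := h
    set a := α (Fin.last n) with ha
    have ha1 : 1 < a := h₁ _
    have h' : IsInvariantFactors ((i : Fin n) → ZMod (α i.castSucc)) fun i => α i.castSucc :=
      ⟨fun i => h₁ _, fun i j hij => h₂ _ _ hij, ⟨AddEquiv.refl _⟩⟩
    have hle : ∀ i : Fin n, α i.castSucc ∣ a := fun i => h₂ _ _ (Fin.le_last _)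
    have e : G ≃+ ZMod a × ((i : Fin n) → ZMod (α i.castSucc)) := f.trans (zmodPiSnocEquiv α)
    obtain ⟨t, m, hm, hat⟩ := Nat.exists_eq_pow_mul_and_not_dvd (n := a) (by omega) q hq.ne_one
    have hmq : ∀ k, (q ^ k).Coprime m := fun k => ((hq.coprime_iff_not_dvd).2 hm).pow_left k
    -- If `s ≤ t`, insert `q ^ s` below and put `a` back on top. Otherwise the top becomes `q ^ s *
    -- m`, and `q ^ t` is inserted below.
    rcases le_total s t with hst | hst
    · have hsa : q ^ s ∣ a := hat ▸ (pow_dvd_pow q hst).mul_right m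
      refine (((ih h' hle hsa).prod_zmod ha1).mono (hα _)).congr
        ((e.prodCongr (AddEquiv.refl _)).trans ?_)
      exact
        { toFun := fun x => ((x.1.2, x.2), x.1.1)
          invFun := fun x => ((x.2, x.1.1), x.1.2)
          left_inv := fun _ => rfl
          right_inv := fun _ => rfl
          map_add' := fun _ _ => rfl }
    · have hac : a ∣ q ^ s * m := hat ▸ mul_dvd_mul_right (pow_dvd_pow q hst) m
      have hc1 : 1 < q ^ s * m := ha1.trans_le (Nat.le_of_dvd (Nat.pos_of_ne_zero fun h0 => by
        rcases Nat.mul_eq_zero.1 h0 with h0 | h0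
        · exact (pow_pos hq.pos s).ne' h0
        · simp [h0] at hm) hac)
      have hcN : q ^ s * m ∣ N :=
        (hmq s).mul_dvd_of_dvd_of_dvd hs ((Dvd.intro_left _ hat.symm).trans (hα _))
      have e' : ZMod a ≃+ ZMod (q ^ t) × ZMod m :=
        hat ▸ (ZMod.chineseRemainder (hmq t)).toAddEquiv
      have e'' := (ZMod.chineseRemainder (hmq s)).toAddEquiv
      refine ((((ih h' hle (hat ▸ dvd_mul_right _ m : q ^ t ∣ a)).mono hac).prod_zmod
        hc1).mono hcN).congr (((e.trans (e'.prodCongr (AddEquiv.refl _))).prodCongr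
          (AddEquiv.refl _)).trans (AddEquiv.trans ?_ ((AddEquiv.refl _).prodCongr e''.symm)))
      exact
        { toFun := fun x => ((x.1.2, x.1.1.1), (x.2, x.1.1.2))
          invFun := fun x => (((x.1.2, x.2.2), x.1.1), x.2.1)
          left_inv := fun _ => rfl
          right_inv := fun _ => rfl
          map_add' := fun _ _ => rfl }

theorem exists_isInvariantFactors {k : ℕ} (p r : Fin k → ℕ) (hp : ∀ i, (p i).Prime) :
    ∃ (n : ℕ) (α : Fin n → ℕ), IsInvariantFactors (PrimePowerProduct p r) α := by
  -- Every integer divides 0, so the bound 0 is no restriction.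
  suffices h : HasInvariantFactorsDvd (PrimePowerProduct p r) 0 by
    obtain ⟨n, α, h, -⟩ := h
    exact ⟨n, α, h⟩
  induction k with
  | zero => exact ⟨0, Fin.elim0, ⟨fun i => i.elim0, fun i => i.elim0,
      ⟨{ Equiv.ofUnique (PrimePowerProduct p r) _ with
        map_add' := fun _ _ => Subsingleton.elim _ _ }⟩⟩, fun i => i.elim0⟩
  | succ k ih =>
    obtain ⟨n, α, h, hα⟩ :=
      ih (fun i => p i.castSucc) (fun i => r i.castSucc) fun i => hp _
    exact (h.prod_zmod_prime_pow (hp (Fin.last k)) hα (dvd_zero _)).congr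
      ((zmodPiSnocEquiv fun i => p i ^ r i).trans AddEquiv.prodComm)

/-- The number of invariant factors is the least number of generators. -/
theorem IsInvariantFactors.deficiency_empty [Finite G] {n : ℕ} {α : Fin n → ℕ}
    (h : IsInvariantFactors G α) : deficiency (∅ : Set G) = n := by
  classical
  obtain ⟨h₁, h₂, ⟨e⟩⟩ := h
  apply le_antisymm
  · let T : Finset G := Finset.univ.image fun i : Fin n => e.symm (Pi.single i 1)
    have hT : T.card ≤ n := by simpa using Finset.card_image_le (s := (Finset.univ : Finset (Fin n)))
    refine (deficiency_le T (top_le_iff.1 fun x _ => ?_)).trans hT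
    rw [Set.empty_union, ← e.symm_apply_apply x, ← Finset.univ_sum_single (e x), map_sum]
    refine sum_mem fun i _ => ?_
    have : NeZero (α i) := ⟨(zero_lt_one.trans (h₁ i)).ne'⟩
    have hi : Pi.single i (e x i) =
        (e x i).val • (Pi.single i 1 : (i : Fin n) → ZMod (α i)) := by
      rw [← Pi.single_smul, nsmul_one, ZMod.natCast_zmod_val]
    rw [hi, map_nsmul]
    refine nsmul_mem (AddSubgroup.subset_closure ?_) _
    exact Finset.mem_coe.2 (Finset.mem_image_of_mem _ (Finset.mem_univ i))
  · rcases n with _ | n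
    · exact Nat.zero_le _
    -- A prime dividing the first invariant factor divides all of them, so `G` maps onto an `(n +
    -- 1)`-dimensional space over `ZMod q`. The image of a generating set spans it.
    obtain ⟨q, hq, hqα⟩ := Nat.exists_prime_and_dvd (h₁ 0).ne'
    have := Fact.mk hq
    have hd : ∀ i, q ∣ α i := fun i => hqα.trans (h₂ 0 i (Fin.zero_le i))
    let π : ((i : Fin (n + 1)) → ZMod (α i)) →+ (Fin (n + 1) → ZMod q) :=
      AddMonoidHom.mk' (fun x i => ZMod.castHom (hd i) (ZMod q) (x i)) fun x y =>
        funext fun i => map_add (ZMod.castHom (hd i) (ZMod q)) (x i) (y i)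
    have hπ : Function.Surjective π := fun y => by
      choose x hx using fun i => ZMod.castHom_surjective (hd i) (y i)
      exact ⟨x, funext hx⟩
    let φ : G →+ (Fin (n + 1) → ZMod q) := π.comp e.toAddMonoidHom
    have hφ : Function.Surjective φ := hπ.comp e.surjective
    obtain ⟨T, hT, hgen⟩ := exists_card_eq_deficiency (∅ : Set G)
    rw [Set.empty_union] at hgen
    have hspan : Submodule.span (ZMod q) (T.image φ : Set (Fin (n + 1) → ZMod q)) = ⊤ := by
      refine top_le_iff.1 fun y _ => ?_
      obtain ⟨x, rfl⟩ := hφ y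
      have hle : AddSubgroup.closure (T : Set G) ≤
          (Submodule.span (ZMod q)
            (T.image φ : Set (Fin (n + 1) → ZMod q))).toAddSubgroup.comap φ :=
        (AddSubgroup.closure_le _).2 fun z hz =>
          Submodule.subset_span (Finset.mem_coe.2 (Finset.mem_image_of_mem φ hz))
      exact hle (hgen ▸ AddSubgroup.mem_top x)
    have hfin := finrank_span_finset_le_card (R := ZMod q) (T.image φ)
    rw [Set.finrank, hspan, finrank_top, Module.finrank_fin_fun] at hfin
    exact hT ▸ hfin.trans Finset.card_image_le

theorem spr_eq_deficiency [Finite G]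
    (h : ∃ (n : ℕ) (α : Fin n → ℕ), IsInvariantFactors G α) :
    spr G = deficiency (∅ : Set G) := by
  have hmem := Nat.sInf_mem (s := {n | ∃ α : Fin n → ℕ, IsInvariantFactors G α}) h
  obtain ⟨α, hα⟩ := hmem
  exact hα.deficiency_empty.symm

end Spread

theorem mainTheorem10 {k : ℕ} (p r : Fin k → ℕ) [∀ i, Fact (p i).Prime] (hodd : ∀ i, Odd (p i)) :
    -- the simplified structure diagram
    (spr (PrimePowerProduct p r) = 1 →
      (simplifiedStructureDiagram (PrimePowerProduct p r)).Same (oddAbelianDiagram 1)) ∧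
    (spr (PrimePowerProduct p r) = 2 →
      (simplifiedStructureDiagram (PrimePowerProduct p r)).Same (oddAbelianDiagram 2)) ∧
    (spr (PrimePowerProduct p r) = 3 →
      (simplifiedStructureDiagram (PrimePowerProduct p r)).Same (oddAbelianDiagram 3)) ∧
    (4 ≤ spr (PrimePowerProduct p r) →
      (simplifiedStructureDiagram (PrimePowerProduct p r)).Same (oddAbelianDiagram 4)) ∧
    -- the value of the game, as a game and as a nim-number
    (spr (PrimePowerProduct p r) = 0 →
      (GEN (PrimePowerProduct p r)).Equal (ImpartialGame.nimber 0) ∧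
        (GEN (PrimePowerProduct p r)).nimNumber = 0) ∧
    (1 ≤ spr (PrimePowerProduct p r) ∧ spr (PrimePowerProduct p r) ≤ 2 →
      (GEN (PrimePowerProduct p r)).Equal (ImpartialGame.nimber 2) ∧
        (GEN (PrimePowerProduct p r)).nimNumber = 2) ∧
    (3 ≤ spr (PrimePowerProduct p r) →
      (GEN (PrimePowerProduct p r)).Equal (ImpartialGame.nimber 1) ∧
        (GEN (PrimePowerProduct p r)).nimNumber = 1) := by
  have hp : ∀ i, (p i).Prime := fun i => Fact.out
  have hG : Odd (Nat.card (PrimePowerProduct p r)) := by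
    rw [Nat.card_pi]
    simp only [Nat.card_zmod]
    exact Finset.prod_induction _ Odd (fun _ _ => Odd.mul) odd_one fun i _ => (hodd i).pow
  have hspr : spr (PrimePowerProduct p r) = deficiency (∅ : Set (PrimePowerProduct p r)) :=
    spr_eq_deficiency (exists_isInvariantFactors p r hp)
  have hdiagram : 1 ≤ spr (PrimePowerProduct p r) → ∀ m, m = min (spr (PrimePowerProduct p r)) 4 →
      (simplifiedStructureDiagram (PrimePowerProduct p r)).Same (oddAbelianDiagram m) := by
    intro h1 m hm
    -- A trivial group has deficiency 0, hence spread 0.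
    have : Nontrivial (PrimePowerProduct p r) := by
      by_contra hnt
      rw [not_nontrivial_iff_subsingleton] at hnt
      have := deficiency_eq_zero.2
        (Subsingleton.elim (AddSubgroup.closure (∅ : Set (PrimePowerProduct p r))) ⊤)
      omega
    exact simplifiedStructureDiagram_same hG (hspr ▸ hm)
  have hnim := nimNumber_GEN hG
  rw [← hspr] at hnim
  have hval : ∀ n, (oddAbelianType (spr (PrimePowerProduct p r))).2.1 = n →
      (GEN (PrimePowerProduct p r)).Equal (ImpartialGame.nimber n) ∧
        (GEN (PrimePowerProduct p r)).nimNumber = n := fun n hn =>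
    ⟨ImpartialGame.equal_nimber _ (hnim.trans hn), hnim.trans hn⟩
  refine ⟨fun h => hdiagram (by omega) 1 (by omega), fun h => hdiagram (by omega) 2 (by omega),
    fun h => hdiagram (by omega) 3 (by omega), fun h => hdiagram (by omega) 4 (by omega),
    fun h => hval 0 (by rw [h]; rfl), fun h => hval 2 ?_, fun h => hval 1 ?_⟩
  · obtain h | h : spr (PrimePowerProduct p r) = 1 ∨ spr (PrimePowerProduct p r) = 2 := by omega
    all_goals rw [h]; rfl
  · obtain ⟨d, hd⟩ := Nat.exists_eq_add_of_le' h
    rw [hd]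
    rfl
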